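/- Let $N\ge 0$ and $1\le r\le C$ be integers. In the combinatorial multi-access network a server holds $N$ files $W_1,\dots,W_N\in\mathbb F_2^F$; there are $C$ caches and $K=\binom{C}{r}$ users $U_g$, one for each $r$-subset $g$ of $[C]$, and $U_g$ reads the caches in $g$ and wants the linear combination $B_g=\sum_n d_{g,n}W_n$, with $d_g\in\mathbb F_2^N$. A scheme with caches of $m$ bits and a message of $n$ bits consists of a finite set $\mathcal P$, cache functions that determine the content $Z_c\in\mathbb F_2^m$ of each cache $c$ from $(P,W_{[N]})$, where $P$ is uniform on $\mathcal P$, and a function that determines the broadcast message $X\in\mathbb F_2^n$ from $(P,(d_g)_g,W_{[N]})$. With $Z_g=(Z_c)_{c\in g}$, it is an *SP-LFR scheme* (secure, private linear function retrieval) if, whatever the laws of the library $W_{[N]}$ and of the demand vectors $d_g$ are, with $P$, $W_{[N]}$ and all the $d_g$ independent, for every $g$ $$H(B_g\mid X,d_g,Z_g)=0,\qquad I(W_{[N]};X)=0,\qquad I\big((d_h)_{h\ne g};X,d_g,Z_g\big)=0 .$$ It has *subpacketization* $L$ if every file is split into $L$ subfiles of equal size and the cache contents and the message are concatenations of blocks,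 each of which is a key plus an $\mathbb F_2$-linear combination of zero-padded (or truncated) subfiles; in the caches, the keys and the coefficients of these combinations are functions of $P$ only, and in the message they are functions of $P$ and the demands only. Let $l$ be the smallest positive integer with $r<2^l$, and for $t\in\{0,\dots,C-r\}$ and $F\ge 1$ let $$M_t(F)=\frac{Nt}{C}+\binom{C-r}{t}\binom{C-1}{r-1}\left\lceil\frac{F}{l\binom{C}{t}}\right\rceil\frac{l}{F},\qquad R_t=\frac{\binom{C}{t+r}}{\binom{C}{t}} .$$ 1. For every $t\in\{0,\dots,C-r\}$ and every $F\ge1$ divisible by $\binom{C}{t}$ there is an SP-LFR scheme with subpacketization $\binom{C}{t}$, caches of exactly $M_t(F)F$ bits and a message of exactly $R_tF+KN$ bits (so that its rate is $R_t$ up to $KN$ bits, a number that does not depend on $F$). 2. For every $F\ge 1$ there is an SP-LFR scheme with caches of $NF$ bits and an empty message; that is, $(N,0)$ is achieved. 3. The lower convex envelope is achieved: there is a constant $\kappa$, depending only on $N,C,r$, such that for every $F\ge1$ that is divisible by $\binom{C}{t}$ for all $t\in\{0,\dots,C-r\}$, and every point $(M,R)$ of the lower boundary of the convex hull of $\{(M_t(F),R_t):0\le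 t\le C-r\}\cup\{(N,0)\}$, there is an SP-LFR scheme with caches of at most $MF$ bits and a message of at most $RF+\kappa$ bits. -/

import Mathlib

open scoped Classical in
/-- The probability that the random variable `X` takes the value `a`, when the outcome `ω` of the
finite sample space has probability `q ω`. -/
noncomputable def probEq {Ω α : Type} [Fintype Ω] (q : Ω → ℝ) (X : Ω → α) (a : α) : ℝ :=
  ∑ ω with X ω = a, q ω

/-- Shannon entropy `H(X)` in bits. -/
noncomputable def entropy {Ω α : Type} [Fintype Ω] [Fintype α] (q : Ω → ℝ) (X : Ω → α) : ℝ :=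
  ∑ a, Real.negMulLog (probEq q X a) / Real.log 2

/-- Conditional entropy `H(X | Y) = H(X, Y) - H(Y)`. -/
noncomputable def condEntropy {Ω α β : Type} [Fintype Ω] [Fintype α] [Fintype β]
    (q : Ω → ℝ) (X : Ω → α) (Y : Ω → β) : ℝ :=
  entropy q (fun ω => (X ω, Y ω)) - entropy q Y

/-- Mutual information `I(X ; Y) = H(X) + H(Y) - H(X, Y)`. -/
noncomputable def mutualInfo {Ω α β : Type} [Fintype Ω] [Fintype α] [Fintype β]
    (q : Ω → ℝ) (X : Ω → α) (Y : Ω → β) : ℝ :=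
  entropy q X + entropy q Y - entropy q (fun ω => (X ω, Y ω))

/-- A user of the combinatorial multi-access network with `C` caches and access degree `r`: there is
exactly one user for each set of `r` caches, and it reads the caches in that set. -/
abbrev User (C r : ℕ) : Type := {g : Finset (Fin C) // g.card = r}

/-- The server's library: `N` files of `F` bits. -/
abbrev Library (N F : ℕ) : Type := Fin N → Fin F → ZMod 2

/-- A demand vector: the coefficients of a linear combination of the `N` files. -/
abbrev Demand (N : ℕ) : Type := Fin N → ZMod 2

/-- The linear combination `d₁ W₁ + ⋯ + d_N W_N` of the files. -/
def linComb {N F : ℕ} (d : Demand N) (W : Library N F) : Fin F → ZMod 2 :=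
  ∑ i, d i • W i

/-- A coded caching scheme for `N` files of `F` bits, with caches of `m` bits and a broadcast
message of `n` bits: the server draws an element of the finite set `Rand` uniformly at random, fills
the caches with `place` before the demands are known, and answers the demands with `send`. -/
structure CachingScheme (N C r F m n : ℕ) where
  Rand : Type
  [fintypeRand : Fintype Rand]
  [nonemptyRand : Nonempty Rand]
  place : Fin C → Rand → Library N F → (Fin m → ZMod 2)
  send : Rand → (User C r → Demand N) → Library N F → (Fin n → ZMod 2)

attribute [instance] CachingScheme.fintypeRand CachingScheme.nonemptyRand

namespace CachingScheme

variable {N C r F m n : ℕ}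

/-- The sample space: server randomness, demands of all users, library. -/
abbrev Outcome (S : CachingScheme N C r F m n) : Type :=
  S.Rand × (User C r → Demand N) × Library N F

/-- The joint distribution: the server's randomness is uniform, the library has law `pW`, the demand
of the user `g` has law `pd g`, and all of them are independent. -/
noncomputable def jointProb (S : CachingScheme N C r F m n) (pW : PMF (Library N F))
    (pd : User C r → PMF (Demand N)) (ω : S.Outcome) : ℝ :=
  (Fintype.card S.Rand : ℝ)⁻¹ * (∏ g, (pd g (ω.2.1 g)).toReal) * (pW ω.2.2).toReal

/-- The library `W_{[N]}`. -/
def files (S : CachingScheme N C r F m n) (ω : S.Outcome) : Library N F := ω.2.2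

/-- The demand vector `d_g` of the user `g`. -/
def demand (S : CachingScheme N C r F m n) (g : User C r) (ω : S.Outcome) : Demand N := ω.2.1 g

/-- The demand vectors of all users other than `g`. -/
def otherDemands (S : CachingScheme N C r F m n) (g : User C r) (ω : S.Outcome) :
    {h : User C r // h ≠ g} → Demand N :=
  fun h => ω.2.1 h.1

/-- The linear combination `B_g` that the user `g` wants. -/
def wanted (S : CachingScheme N C r F m n) (g : User C r) (ω : S.Outcome) : Fin F → ZMod 2 :=
  linComb (ω.2.1 g) ω.2.2

/-- The contents `Z_g` of the caches that the user `g` reads. -/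
def cached (S : CachingScheme N C r F m n) (g : User C r) (ω : S.Outcome) :
    {c : Fin C // c ∈ g.1} → Fin m → ZMod 2 :=
  fun c => S.place c.1 ω.1 ω.2.2

/-- The broadcast message `X`. -/
def message (S : CachingScheme N C r F m n) (ω : S.Outcome) : Fin n → ZMod 2 :=
  S.send ω.1 ω.2.1 ω.2.2

/-- Secure and private linear function retrieval: whatever the laws of the library and of the
demands are, every user decodes the linear combination it wants (correctness), the message reveals
nothing about the library (security), and no user learns anything about the demands of the other
users (privacy). -/
def IsSPLFR (S : CachingScheme N C r F m n) : Prop :=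
  ∀ (pW : PMF (Library N F)) (pd : User C r → PMF (Demand N)),
    (∀ g : User C r, condEntropy (S.jointProb pW pd) (S.wanted g)
      (fun ω => (S.message ω, S.demand g ω, S.cached g ω)) = 0) ∧
    mutualInfo (S.jointProb pW pd) S.files S.message = 0 ∧
    (∀ g : User C r, mutualInfo (S.jointProb pW pd) (S.otherDemands g)
      (fun ω => (S.message ω, S.demand g ω, S.cached g ω)) = 0)

end CachingScheme

/-- Let `e` split every file into `L` subfiles of `s` bits. The word `f`, a function of some data `σ`
and of the library, *operates on subfiles* if it is a concatenation of blocks, each of which is the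
sum of a key that depends on `σ` only and of an `𝔽₂`-linear combination of whole subfiles (padded by
zeros, or cut off, to the length of the block) whose coefficients depend on `σ` only. A block may in
particular be a plain subfile, or a word that does not involve the library. -/
def OperatesOnSubfiles {N F L s k : ℕ} {σ : Type} (e : Fin L × Fin s ≃ Fin F)
    (f : σ → Library N F → Fin k → ZMod 2) : Prop :=
  ∃ (J : ℕ) (len : Fin J → ℕ) (pos : (Σ j : Fin J, Fin (len j)) ≃ Fin k)
    (key : σ → (j : Fin J) → Fin (len j) → ZMod 2)
    (coef : σ → Fin J → Fin N → Fin L → ZMod 2),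
    ∀ (x : σ) (W : Library N F) (j : Fin J) (b : Fin (len j)),
      f x W (pos ⟨j, b⟩) = key x j b +
        ∑ i, ∑ u, coef x j i u * (if h : b.1 < s then W i (e (u, ⟨b.1, h⟩)) else 0)

/-- The scheme has subpacketization `L`: every file is split into `L` subfiles of the same size, and
the cache contents and the message are formed from whole subfiles. -/
def CachingScheme.HasSubpacketization {N C r F m n : ℕ} (S : CachingScheme N C r F m n) (L : ℕ) :
    Prop :=
  ∃ (s : ℕ) (e : Fin L × Fin s ≃ Fin F),
    (∀ c, OperatesOnSubfiles e (S.place c)) ∧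
    OperatesOnSubfiles e
      (fun (x : S.Rand × (User C r → Demand N)) (W : Library N F) => S.send x.1 x.2 W)

/-- The smallest positive integer `l` with `r < 2 ^ l`. -/
noncomputable def fieldDegree (r : ℕ) : ℕ := sInf {l : ℕ | 0 < l ∧ r < 2 ^ l}

/-- The cache size `M` (in files) of the point with parameter `t`, for files of `F` bits. -/
noncomputable def memorySP (N C r F t : ℕ) : ℝ :=
  (N : ℝ) * t / C + ((C - r).choose t : ℝ) * ((C - 1).choose (r - 1) : ℝ) *
    (⌈(F : ℝ) / ((fieldDegree r : ℝ) * (C.choose t : ℝ))⌉₊ : ℝ) * ((fieldDegree r : ℝ) / F)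

/-- The rate `R` (in files) of the point with parameter `t`. -/
noncomputable def rateSP (C r t : ℕ) : ℝ := (C.choose (t + r) : ℝ) / (C.choose t : ℝ)

/-- The memory-rate pairs: one for each `t ∈ {0, …, C - r}`, and `(N, 0)`. -/
def pointsSP (N C r F : ℕ) : Set (ℝ × ℝ) :=
  {p | ∃ t : ℕ, t ≤ C - r ∧ p = (memorySP N C r F t, rateSP C r t)} ∪ {((N : ℝ), 0)}

/-- The lower convex envelope of a set of points of the plane: the lower boundary of its convex
hull. -/
def lowerConvexEnvelope (A : Set (ℝ × ℝ)) : Set (ℝ × ℝ) :=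
  {p | p ∈ convexHull ℝ A ∧ ∀ q ∈ convexHull ℝ A, q.1 = p.1 → p.2 ≤ q.2}

/-! All three requirements reduce to combinatorics (`CachingScheme.IsPerfect`). It suffices that
decoding is deterministic and that a change of the library, or of the demands of the users other
than g, can be compensated by a permutation of the uniform randomness that preserves the message,
respectively everything g sees. The joint laws in question then factorize, whatever the laws of
library and demands.

For the parameter t, subfiles are indexed by t-subsets T of the caches, and cache c stores those
with c ∈ T; user g misses T exactly when g and T are disjoint. Each (t+r)-set A gets one
transmission: a uniform mask plus, for every splitting A = g ⊔ T, the combination of the subfiles T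
with coefficients p_g + d_g. Here p_g is a uniform mask of the demand, and p_g + d_g is sent in the
clear. The key of g for T, namely the mask of A plus the p_g-combination of the subfiles T, is
shared additively among the caches of g. Subtracting it from the transmission leaves the
d_g-combination plus terms that g knows, by `Missing.eq_of_union_eq`.

The masks of the transmissions hide the library. For privacy, shifting p_h compensates a change of
d_h; the key of h changes, but a share in a cache of h outside g absorbs this
(`exists_keyShare_eq`). Additive sharing works over 𝔽₂ itself, so l enters only through zero padding
of the shares, which makes the memory exactly M_t(F).

For the envelope, files are cut into chunks whose length D is the lcm of the binomials, and whole
chunks are distributed among the unpadded schemes. Rounding the weights costs no memory and a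
bounded number of chunks of rate (`exists_rounded_weights`). -/

/-! ### Entropy of determined and of independent variables -/

section Information

variable {Ω α β : Type} [Fintype Ω]

lemma probEq_eq_zero (q : Ω → ℝ) (X : Ω → α) (a : α) (h : ∀ ω, X ω ≠ a) : probEq q X a = 0 := by
  classical
  simp [probEq, h]

lemma sum_probEq [Fintype α] (q : Ω → ℝ) (X : Ω → α) : ∑ a, probEq q X a = ∑ ω, q ω := by
  classical
  unfold probEq
  exact Finset.sum_fiberwise _ _ _

lemma sum_probEq_prodMk_right [Fintype β] (q : Ω → ℝ) (X : Ω → α) (Y : Ω → β) (a : α) :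
    ∑ b, probEq q (fun ω => (X ω, Y ω)) (a, b) = probEq q X a := by
  classical
  simp only [probEq, Finset.sum_filter, Prod.mk.injEq]
  rw [Finset.sum_comm]
  refine Finset.sum_congr rfl fun ω _ => ?_
  by_cases h : X ω = a <;> simp [h]

lemma sum_probEq_prodMk_left [Fintype α] (q : Ω → ℝ) (X : Ω → α) (Y : Ω → β) (b : β) :
    ∑ a, probEq q (fun ω => (X ω, Y ω)) (a, b) = probEq q Y b := by
  classical
  simp only [probEq, Finset.sum_filter, Prod.mk.injEq]
  rw [Finset.sum_comm]
  refine Finset.sum_congr rfl fun ω _ => ?_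
  by_cases h : Y ω = b <;> simp [h]

variable [Fintype α] [Fintype β]

/-- A variable that is determined by `Y` has no entropy given `Y`. -/
lemma condEntropy_eq_zero_of_determined (q : Ω → ℝ) (X : Ω → α) (Y : Ω → β)
    (h : ∀ ω ω', Y ω = Y ω' → X ω = X ω') : condEntropy q X Y = 0 := by
  classical
  unfold condEntropy entropy
  rw [sub_eq_zero, Fintype.sum_prod_type_right]
  refine Finset.sum_congr rfl fun b _ => ?_
  by_cases hb : ∃ ω, Y ω = b
  · obtain ⟨ω₀, rfl⟩ := hb
    rw [Finset.sum_eq_single (X ω₀)]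
    · congr 2
      simp only [probEq, Prod.mk.injEq]
      refine Finset.sum_congr (Finset.filter_congr fun ω _ => ?_) fun _ _ => rfl
      exact ⟨fun hω => hω.2, fun hω => ⟨h _ _ hω, hω⟩⟩
    · intro a _ ha
      rw [probEq_eq_zero, Real.negMulLog_zero, zero_div]
      intro ω hω
      rw [Prod.mk.injEq] at hω
      exact ha (hω.1.symm.trans (h _ _ hω.2))
    · simp
  · push Not at hb
    rw [probEq_eq_zero q Y b hb]
    refine (Finset.sum_eq_zero fun a _ => ?_).trans (by simp)
    rw [probEq_eq_zero, Real.negMulLog_zero, zero_div]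
    intro ω hω
    rw [Prod.mk.injEq] at hω
    exact hb ω hω.2

/-- Variables whose joint distribution factorizes have no mutual information. -/
lemma mutualInfo_eq_zero_of_factorizes (q : Ω → ℝ) (hq : ∑ ω, q ω = 1) (X : Ω → α) (Y : Ω → β)
    (μ : α → ℝ) (ν : β → ℝ)
    (h : ∀ a b, probEq q (fun ω => (X ω, Y ω)) (a, b) = μ a * ν b) : mutualInfo q X Y = 0 := by
  have hX : ∀ a, probEq q X a = μ a * ∑ b, ν b := fun a => by
    rw [← sum_probEq_prodMk_right q X Y, Finset.mul_sum]
    exact Finset.sum_congr rfl fun b _ => h a b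
  have hY : ∀ b, probEq q Y b = (∑ a, μ a) * ν b := fun b => by
    rw [← sum_probEq_prodMk_left q X Y, Finset.sum_mul]
    exact Finset.sum_congr rfl fun a _ => h a b
  have hX1 : ∑ a, probEq q X a = 1 := (sum_probEq q X).trans hq
  have hY1 : ∑ b, probEq q Y b = 1 := (sum_probEq q Y).trans hq
  -- `μ` and `ν` need not be normalized: it is enough that their total masses multiply to 1.
  have htot : (∑ a, μ a) * ∑ b, ν b = 1 := by
    rw [← hX1, Finset.sum_mul]
    exact Finset.sum_congr rfl fun a _ => (hX a).symm
  have hXY : ∀ a b, probEq q (fun ω => (X ω, Y ω)) (a, b) = probEq q X a * probEq q Y b := by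
    intro a b
    rw [h, hX, hY]
    linear_combination -(μ a * ν b) * htot
  have key : entropy q (fun ω => (X ω, Y ω)) = entropy q X + entropy q Y := by
    unfold entropy
    simp only [← Finset.sum_div, ← add_div]
    congr 1
    rw [Fintype.sum_prod_type]
    simp only [hXY, Real.negMulLog_mul, Finset.sum_add_distrib, ← Finset.sum_mul, ← Finset.mul_sum,
      hX1, hY1, one_mul]
  rw [mutualInfo, key, sub_self]

end Information

lemma PMF.sum_toReal {α : Type} [Fintype α] (p : PMF α) : ∑ a, (p a).toReal = 1 := by
  rw [← ENNReal.toReal_sum fun a _ => p.apply_ne_top a, ← tsum_fintype (L := .unconditional _),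
    p.tsum_coe, ENNReal.toReal_one]

/-! ### Perfect schemes satisfy the information-theoretic conditions -/

namespace CachingScheme

variable {N C r F m n : ℕ}

lemma sum_jointProb (S : CachingScheme N C r F m n) (pW : PMF (Library N F))
    (pd : User C r → PMF (Demand N)) : ∑ ω, S.jointProb pW pd ω = 1 := by
  classical
  have hd : ∑ d : User C r → Demand N, ∏ g, (pd g (d g)).toReal = 1 := by
    rw [← Fintype.prod_sum fun g δ => (pd g δ).toReal]
    exact Finset.prod_eq_one fun g _ => (pd g).sum_toReal
  simp only [jointProb, Fintype.sum_prod_type, ← Finset.mul_sum, PMF.sum_toReal, mul_one, hd]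
  simp

/-- The combinatorial form of correctness, security and privacy: users decode with certainty, and
changing the library, or the demands of the other users, amounts to permuting the server's
randomness. -/
structure IsPerfect (S : CachingScheme N C r F m n) : Prop where
  decodes : ∀ (g : User C r) (P P' : S.Rand) (d d' : User C r → Demand N) (W W' : Library N F),
    S.send P d W = S.send P' d' W' → d g = d' g →
    (∀ c ∈ g.1, S.place c P W = S.place c P' W') → linComb (d g) W = linComb (d' g) W'
  hidesLibrary : ∀ (d : User C r → Demand N) (W W' : Library N F),
    ∃ e : Equiv.Perm S.Rand, ∀ P, S.send (e P) d W' = S.send P d W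
  hidesDemands : ∀ (g : User C r) (W : Library N F) (d d' : User C r → Demand N), d g = d' g →
    ∃ e : Equiv.Perm S.Rand, ∀ P, S.send (e P) d' W = S.send P d W ∧
      ∀ c ∈ g.1, S.place c (e P) W = S.place c P W

/-- For fixed demands, the number of keys that give the message x is the same for every library, so
it may be counted at the zero library. -/
lemma IsPerfect.mutualInfo_files_message {S : CachingScheme N C r F m n} (hS : S.IsPerfect)
    (pW : PMF (Library N F)) (pd : User C r → PMF (Demand N)) :
    mutualInfo (S.jointProb pW pd) S.files S.message = 0 := by
  classical
  refine mutualInfo_eq_zero_of_factorizes _ (S.sum_jointProb pW pd) _ _ (fun W => (pW W).toReal)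
    (fun x => ∑ d : User C r → Demand N, ∑ P : S.Rand, if S.send P d 0 = x then
      (Fintype.card S.Rand : ℝ)⁻¹ * ∏ g, (pd g (d g)).toReal else 0) fun W x => ?_
  simp only [probEq, Finset.sum_filter, Fintype.sum_prod_type, Prod.mk.injEq, files, message,
    jointProb, ite_and, Finset.sum_ite_eq', Finset.mem_univ, if_true]
  rw [Finset.sum_comm, Finset.mul_sum]
  refine Finset.sum_congr rfl fun d _ => ?_
  obtain ⟨e, he⟩ := hS.hidesLibrary d 0 W
  rw [← Equiv.sum_comp e, Finset.mul_sum]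
  refine Finset.sum_congr rfl fun P _ => ?_
  rw [he, mul_ite, mul_zero]
  split_ifs <;> ring

/-- For a fixed library and a fixed own demand, the number of keys that give a certain view of g
does not depend on the other demands, so it may be counted with these set to zero. -/
lemma IsPerfect.mutualInfo_otherDemands {S : CachingScheme N C r F m n} (hS : S.IsPerfect)
    (pW : PMF (Library N F)) (pd : User C r → PMF (Demand N)) (g : User C r) :
    mutualInfo (S.jointProb pW pd) (S.otherDemands g)
      (fun ω => (S.message ω, S.demand g ω, S.cached g ω)) = 0 := by
  classical
  let glue (a : {h : User C r // h ≠ g} → Demand N) (δ : Demand N) : User C r → Demand N :=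
    fun h => if hh : h = g then δ else a ⟨h, hh⟩
  have glue_self : ∀ a δ, glue a δ g = δ := fun a δ => by simp [glue]
  have glue_other : ∀ a δ (h : {h : User C r // h ≠ g}), glue a δ h.1 = a h := fun a δ h => by
    simp [glue, h.2]
  have glue_iff : ∀ a δ (d : User C r → Demand N),
      ((fun h : {h : User C r // h ≠ g} => d h.1) = a ∧ d g = δ) ↔ d = glue a δ := by
    intro a δ d
    constructor
    · rintro ⟨rfl, rfl⟩
      funext h
      by_cases hh : h = g
      · simp [glue, hh]
      · simp [glue, hh]
    · rintro rfl
      exact ⟨funext fun h => glue_other _ _ h, glue_self _ _⟩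
  have hprod : ∀ a δ, ∏ h, (pd h (glue a δ h)).toReal =
      (∏ h : {h : User C r // h ≠ g}, (pd h.1 (a h)).toReal) * (pd g δ).toReal := by
    intro a δ
    rw [Fintype.prod_eq_mul_prod_subtype_ne _ g, glue_self, mul_comm]
    congr 1
    exact Finset.prod_congr rfl fun h _ => by rw [glue_other]
  refine mutualInfo_eq_zero_of_factorizes _ (S.sum_jointProb pW pd) _ _
    (fun a => ∏ h, (pd h.1 (a h)).toReal)
    (fun y => ∑ W : Library N F, ∑ P : S.Rand,
      if S.send P (glue 0 y.2.1) W = y.1 ∧ (fun c : {c // c ∈ g.1} => S.place c.1 P W) = y.2.2 then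
      (Fintype.card S.Rand : ℝ)⁻¹ * (pd g y.2.1).toReal * (pW W).toReal else 0) ?_
  rintro a ⟨x, δ, z⟩
  have hsplit : ∀ (P : S.Rand) (d : User C r → Demand N) (W : Library N F),
      (S.otherDemands g (P, d, W) = a ∧ S.send P d W = x ∧ d g = δ ∧
        S.cached g (P, d, W) = z) ↔
      (d = glue a δ ∧ S.send P d W = x ∧ (fun c : {c // c ∈ g.1} => S.place c.1 P W) = z) := by
    intro P d W
    rw [← glue_iff]
    exact ⟨fun h => ⟨⟨h.1, h.2.2.1⟩, h.2.1, h.2.2.2⟩, fun h => ⟨h.1.1, h.2.1, h.1.2, h.2.2⟩⟩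
  simp only [probEq, Finset.sum_filter, Fintype.sum_prod_type, Prod.mk.injEq, demand, message,
    jointProb, hsplit]
  have hsum : ∀ P : S.Rand, (∑ d : User C r → Demand N, ∑ W : Library N F,
      if d = glue a δ ∧ S.send P d W = x ∧ (fun c : {c // c ∈ g.1} => S.place c.1 P W) = z then
        (Fintype.card S.Rand : ℝ)⁻¹ * (∏ h, (pd h (d h)).toReal) * (pW W).toReal else 0) =
      ∑ W : Library N F,
      if S.send P (glue a δ) W = x ∧ (fun c : {c // c ∈ g.1} => S.place c.1 P W) = z then
        (Fintype.card S.Rand : ℝ)⁻¹ * (∏ h, (pd h (glue a δ h)).toReal) * (pW W).toReal else 0 := by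
    intro P
    rw [Finset.sum_eq_single (glue a δ)]
    · simp
    · intro d _ hd
      simp [hd]
    · simp
  simp only [hsum]
  rw [Finset.sum_comm, Finset.mul_sum]
  refine Finset.sum_congr rfl fun W _ => ?_
  obtain ⟨e, he⟩ := hS.hidesDemands g W (glue 0 δ) (glue a δ) (by rw [glue_self, glue_self])
  rw [← Equiv.sum_comp e, Finset.mul_sum]
  refine Finset.sum_congr rfl fun P _ => ?_
  have hc : (fun c : {c // c ∈ g.1} => S.place c.1 (e P) W) = fun c => S.place c.1 P W :=
    funext fun c => (he P).2 c.1 c.2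
  rw [(he P).1, hc, mul_ite, mul_zero, hprod]
  split_ifs <;> ring

theorem IsPerfect.isSPLFR {S : CachingScheme N C r F m n} (hS : S.IsPerfect) : S.IsSPLFR := by
  intro pW pd
  refine ⟨fun g => condEntropy_eq_zero_of_determined _ _ _ ?_, hS.mutualInfo_files_message pW pd,
    hS.mutualInfo_otherDemands pW pd⟩
  intro ω ω' h
  simp only [Prod.mk.injEq] at h
  exact hS.decodes g ω.1 ω'.1 ω.2.1 ω'.2.1 ω.2.2 ω'.2.2 h.1 h.2.1
    fun c hc => congrFun h.2.2 ⟨c, hc⟩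

end CachingScheme

/-! ### Memory sharing and the uncoded scheme -/

lemma Fin.append_eq_append_iff {α : Type*} {m n : ℕ} {x x' : Fin m → α} {y y' : Fin n → α} :
    Fin.append x y = Fin.append x' y' ↔ x = x' ∧ y = y' := by
  refine ⟨fun h => ⟨funext fun i => ?_, funext fun i => ?_⟩, fun h => by rw [h.1, h.2]⟩
  · simpa using congrFun h (Fin.castAdd n i)
  · simpa using congrFun h (Fin.natAdd m i)

lemma linComb_apply {N F : ℕ} (d : Demand N) (W : Library N F) (b : Fin F) :
    linComb d W b = ∑ i, d i * W i b := by
  simp [linComb, Finset.sum_apply]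

namespace CachingScheme

variable {N C r : ℕ}

/-- Memory sharing: the files are cut into two parts, which are treated by separate schemes. -/
def concat {F₁ m₁ n₁ F₂ m₂ n₂ : ℕ} (S₁ : CachingScheme N C r F₁ m₁ n₁)
    (S₂ : CachingScheme N C r F₂ m₂ n₂) :
    CachingScheme N C r (F₁ + F₂) (m₁ + m₂) (n₁ + n₂) where
  Rand := S₁.Rand × S₂.Rand
  place c P W := Fin.append (S₁.place c P.1 fun i b => W i (Fin.castAdd F₂ b))
    (S₂.place c P.2 fun i b => W i (Fin.natAdd F₁ b))
  send P d W := Fin.append (S₁.send P.1 d fun i b => W i (Fin.castAdd F₂ b))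
    (S₂.send P.2 d fun i b => W i (Fin.natAdd F₁ b))

/-- Linear combinations act bit by bit, so both parts are decoded with the same demand vectors; the
parts have separate keys, so their permutations combine to a product. -/
lemma IsPerfect.concat {F₁ m₁ n₁ F₂ m₂ n₂ : ℕ} {S₁ : CachingScheme N C r F₁ m₁ n₁}
    {S₂ : CachingScheme N C r F₂ m₂ n₂} (h₁ : S₁.IsPerfect) (h₂ : S₂.IsPerfect) :
    (S₁.concat S₂).IsPerfect where
  decodes g P P' d d' W W' hX hd hZ := by
    obtain ⟨hX₁, hX₂⟩ := Fin.append_eq_append_iff.1 hX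
    have e₁ := h₁.decodes g _ _ _ _ _ _ hX₁ hd fun c hc => (Fin.append_eq_append_iff.1 (hZ c hc)).1
    have e₂ := h₂.decodes g _ _ _ _ _ _ hX₂ hd fun c hc => (Fin.append_eq_append_iff.1 (hZ c hc)).2
    funext b
    refine Fin.addCases (fun b => ?_) (fun b => ?_) b
    · simpa only [linComb_apply] using congrFun e₁ b
    · simpa only [linComb_apply] using congrFun e₂ b
  hidesLibrary d W W' := by
    obtain ⟨e₁, he₁⟩ := h₁.hidesLibrary d (fun i b => W i (Fin.castAdd F₂ b))
      (fun i b => W' i (Fin.castAdd F₂ b))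
    obtain ⟨e₂, he₂⟩ := h₂.hidesLibrary d (fun i b => W i (Fin.natAdd F₁ b))
      (fun i b => W' i (Fin.natAdd F₁ b))
    exact ⟨Equiv.prodCongr e₁ e₂, fun P => Fin.append_eq_append_iff.2 ⟨he₁ P.1, he₂ P.2⟩⟩
  hidesDemands g W d d' hd := by
    obtain ⟨e₁, he₁⟩ := h₁.hidesDemands g (fun i b => W i (Fin.castAdd F₂ b)) d d' hd
    obtain ⟨e₂, he₂⟩ := h₂.hidesDemands g (fun i b => W i (Fin.natAdd F₁ b)) d d' hd
    exact ⟨Equiv.prodCongr e₁ e₂, fun P =>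
      ⟨Fin.append_eq_append_iff.2 ⟨(he₁ P.1).1, (he₂ P.2).1⟩, fun c hc =>
        Fin.append_eq_append_iff.2 ⟨(he₁ P.1).2 c hc, (he₂ P.2).2 c hc⟩⟩⟩

/-- Every cache stores the whole library, and nothing is sent. -/
def uncoded (N C r F : ℕ) : CachingScheme N C r F (N * F) 0 where
  Rand := Unit
  place _ _ W := fun j => W (finProdFinEquiv.symm j).1 (finProdFinEquiv.symm j).2
  send _ _ _ := Fin.elim0

lemma isPerfect_uncoded (F : ℕ) (hr : 1 ≤ r) : (uncoded N C r F).IsPerfect where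
  decodes g P P' d d' W W' _ hd hZ := by
    obtain ⟨c, hc⟩ : g.1.Nonempty := Finset.card_pos.1 (by rw [g.2]; exact hr)
    have hW : W = W' := by
      funext i b
      simpa [uncoded] using congrFun (hZ c hc) (finProdFinEquiv (i, b))
    rw [hd, hW]
  hidesLibrary _ _ _ := ⟨Equiv.refl _, fun _ => rfl⟩
  hidesDemands _ _ _ _ _ := ⟨Equiv.refl _, fun _ => ⟨rfl, fun _ _ => rfl⟩⟩

end CachingScheme

/-- There is a perfect scheme with the given parameters. -/
def PerfectlyAchievable (N C r F m n : ℕ) : Prop :=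
  ∃ S : CachingScheme N C r F m n, S.IsPerfect

lemma PerfectlyAchievable.add {N C r F₁ m₁ n₁ F₂ m₂ n₂ : ℕ}
    (h₁ : PerfectlyAchievable N C r F₁ m₁ n₁) (h₂ : PerfectlyAchievable N C r F₂ m₂ n₂) :
    PerfectlyAchievable N C r (F₁ + F₂) (m₁ + m₂) (n₁ + n₂) :=
  let ⟨S₁, hS₁⟩ := h₁
  let ⟨S₂, hS₂⟩ := h₂
  ⟨S₁.concat S₂, hS₁.concat hS₂⟩

lemma PerfectlyAchievable.uncoded {N C r : ℕ} (F : ℕ) (hr : 1 ≤ r) :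
    PerfectlyAchievable N C r F (N * F) 0 :=
  ⟨_, CachingScheme.isPerfect_uncoded F hr⟩

lemma PerfectlyAchievable.sum {N C r : ℕ} {ι : Type*} (hr : 1 ≤ r) (s : Finset ι) (F m n : ι → ℕ)
    (h : ∀ i ∈ s, PerfectlyAchievable N C r (F i) (m i) (n i)) :
    PerfectlyAchievable N C r (∑ i ∈ s, F i) (∑ i ∈ s, m i) (∑ i ∈ s, n i) := by
  classical
  induction s using Finset.induction_on with
  -- The empty sum needs a scheme for files of zero bits.
  | empty => simpa using PerfectlyAchievable.uncoded (N := N) (C := C) 0 hr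
  | insert a s ha ih =>
    simp only [Finset.sum_insert ha]
    exact (h a (Finset.mem_insert_self a s)).add
      (ih fun i hi => h i (Finset.mem_insert_of_mem hi))

/-- Blocks may be indexed by any finite type, and subfiles by any type in bijection with `Fin L`. -/
lemma operatesOnSubfiles_of_blocks {N F L s k : ℕ} {σ ι τ : Type} [Fintype ι] [Fintype τ]
    (eτ : τ ≃ Fin L) (e : Fin L × Fin s ≃ Fin F) (f : σ → Library N F → Fin k → ZMod 2)
    (len : ι → ℕ) (pos : (Σ j : ι, Fin (len j)) ≃ Fin k)
    (key : σ → (j : ι) → Fin (len j) → ZMod 2) (coef : σ → ι → Fin N → τ → ZMod 2)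
    (h : ∀ (x : σ) (W : Library N F) (j : ι) (b : Fin (len j)), f x W (pos ⟨j, b⟩) = key x j b +
      ∑ i, ∑ u, coef x j i u * (if h : b.1 < s then W i (e (eτ u, ⟨b.1, h⟩)) else 0)) :
    OperatesOnSubfiles e f := by
  let eι := Fintype.equivFin ι
  refine ⟨Fintype.card ι, fun j => len (eι.symm j),
    (Equiv.sigmaCongrLeft (β := fun j => Fin (len j)) eι.symm).trans pos,
    fun x j b => key x (eι.symm j) b, fun x j i u => coef x (eι.symm j) i (eτ.symm u), ?_⟩
  intro x W j b
  refine (h x W (eι.symm j) b).trans ?_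
  congr 1
  refine Finset.sum_congr rfl fun i _ => ?_
  rw [← Equiv.sum_comp eτ.symm]
  simp

/-! ### The coded scheme -/

section MultiAccess

variable {C : ℕ}

/-- The `t`-subsets of the caches, which index the subfiles. -/
abbrev Subfile (C t : ℕ) : Type := {T : Finset (Fin C) // T.card = t}

/-- The users and the subfiles that they cannot read. -/
abbrev Missing (C r t : ℕ) : Type := {x : User C r × Subfile C t // Disjoint x.1.1 x.2.1}

namespace Missing

variable {r t : ℕ}

/-- The caches of the user together with those that hold the subfile. -/
def union (x : Missing C r t) : Finset (Fin C) := x.1.1.1 ∪ x.1.2.1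

lemma card_union (x : Missing C r t) : x.union.card = t + r := by
  rw [union, Finset.card_union_of_disjoint x.2, x.1.1.2, x.1.2.2, add_comm]

/-- Among the missing subfiles that are served by one transmission, a user misses only its own. -/
lemma eq_of_union_eq {x y : Missing C r t} (h : x.union = y.union)
    (hd : Disjoint x.1.1.1 y.1.2.1) : x = y := by
  have hT : y.1.2 = x.1.2 := by
    refine Subtype.ext (Finset.eq_of_subset_of_card_le (fun c hc => ?_) ?_)
    · have : c ∈ x.union := h ▸ Finset.mem_union_right _ hc
      exact (Finset.mem_union.1 this).resolve_left fun hc' => Finset.disjoint_left.1 hd hc' hc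
    · rw [x.1.2.2, y.1.2.2]
  have hg : x.1.1 = y.1.1 := by
    refine Subtype.ext (Finset.eq_of_subset_of_card_le (fun c hc => ?_) ?_)
    · have : c ∈ y.union := h ▸ Finset.mem_union_left _ hc
      exact (Finset.mem_union.1 this).resolve_right fun hc' => Finset.disjoint_left.1 hd hc hc'
    · rw [x.1.1.2, y.1.1.2]
  exact Subtype.ext (Prod.ext hg hT.symm)

end Missing

/-- The blocks of a cache: the subfiles that it holds, and its shares of the keys of the users that
read it. -/
abbrev CacheBlock (N r t : ℕ) (c : Fin C) : Type :=
  ({T : Subfile C t // c ∈ T.1} × Fin N) ⊕ {x : Missing C r t // c ∈ x.1.1.1}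

/-- The blocks of the message: coded transmissions, and masked demands. -/
abbrev MessageBlock (N C r t : ℕ) : Type := Subfile C (t + r) ⊕ (User C r × Fin N)

/-- The length of the blocks of a cache; shares are padded to length `k`. -/
def cacheBlockLength (N r t s k : ℕ) (c : Fin C) : CacheBlock N r t c → ℕ
  | .inl _ => s
  | .inr _ => k

/-- The length of the blocks of the message. -/
def messageBlockLength (N C r t s : ℕ) : MessageBlock N C r t → ℕ
  | .inl _ => s
  | .inr _ => 1

/-- The server's randomness: the masks of the transmissions, the random shares, and the masks of the
demands. -/
@[ext] structure Keys (N C r t s : ℕ) where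
  mask : Subfile C (t + r) → Fin s → ZMod 2
  share : Missing C r t → Fin C → Fin s → ZMod 2
  demandMask : User C r → Demand N

namespace Keys

variable {N r t s : ℕ}

def equivProd : Keys N C r t s ≃ (Subfile C (t + r) → Fin s → ZMod 2) ×
    (Missing C r t → Fin C → Fin s → ZMod 2) × (User C r → Demand N) where
  toFun P := (P.mask, P.share, P.demandMask)
  invFun P := ⟨P.1, P.2.1, P.2.2⟩
  left_inv _ := rfl
  right_inv _ := rfl

instance : Finite (Keys N C r t s) := Finite.of_equiv _ equivProd.symm

noncomputable instance : Fintype (Keys N C r t s) := Fintype.ofFinite _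

instance : Nonempty (Keys N C r t s) := ⟨⟨0, 0, 0⟩⟩

/-- Adding fixed keys to the random ones. -/
def translate (Q : Keys N C r t s) : Equiv.Perm (Keys N C r t s) where
  toFun P := ⟨P.mask + Q.mask, P.share + Q.share, P.demandMask + Q.demandMask⟩
  invFun P := ⟨P.mask - Q.mask, P.share - Q.share, P.demandMask - Q.demandMask⟩
  left_inv P := by ext <;> simp
  right_inv P := by ext <;> simp

lemma translate_apply (Q P : Keys N C r t s) : Q.translate P =
    ⟨P.mask + Q.mask, P.share + Q.share, P.demandMask + Q.demandMask⟩ := rfl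

end Keys

variable {N r t s : ℕ}

/-- The linear combination with coefficients `p` of the subfiles with index `T`. -/
def subfileComb (w : Fin N → Subfile C t → Fin s → ZMod 2) (p : Demand N) (T : Subfile C t)
    (b : Fin s) : ZMod 2 :=
  ∑ i, p i * w i T b

lemma subfileComb_add (w : Fin N → Subfile C t → Fin s → ZMod 2) (p q : Demand N)
    (T : Subfile C t) (b : Fin s) :
    subfileComb w (p + q) T b = subfileComb w p T b + subfileComb w q T b := by
  simp [subfileComb, add_mul, Finset.sum_add_distrib]

/-- The index of the transmission that serves a missing subfile. -/
def Missing.transmission (x : Missing C r t) : Subfile C (t + r) := ⟨x.union, x.card_union⟩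

/-- The key of a user for a missing subfile. -/
def userKey (P : Keys N C r t s) (w : Fin N → Subfile C t → Fin s → ZMod 2) (x : Missing C r t)
    (b : Fin s) : ZMod 2 :=
  P.mask x.transmission b + subfileComb w (P.demandMask x.1.1) x.1.2 b

open scoped Classical in
/-- The share of the cache `c` of the key of a user: the shares of the user's caches sum up to the
key. The designated cache `a g` of the user `g` holds the only share that is not random. -/
noncomputable def keyShare (a : User C r → Fin C) (P : Keys N C r t s)
    (w : Fin N → Subfile C t → Fin s → ZMod 2) (x : Missing C r t) (c : Fin C) (b : Fin s) :
    ZMod 2 :=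
  if c = a x.1.1 then userKey P w x b - ∑ c' ∈ x.1.1.1.erase c, P.share x c' b
  else P.share x c b

open scoped Classical in
/-- The transmission with index `A`. -/
noncomputable def transmit (P : Keys N C r t s) (d : User C r → Demand N)
    (w : Fin N → Subfile C t → Fin s → ZMod 2) (A : Subfile C (t + r)) (b : Fin s) : ZMod 2 :=
  P.mask A b + ∑ x : Missing C r t with x.transmission = A,
    subfileComb w (P.demandMask x.1.1 + d x.1.1) x.1.2 b

/-- The bits of a cache. -/
noncomputable def cacheBit (s' : ℕ) (a : User C r → Fin C) (c : Fin C) (P : Keys N C r t s)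
    (w : Fin N → Subfile C t → Fin s → ZMod 2) :
    (j : CacheBlock N r t c) → Fin (cacheBlockLength N r t s s' c j) → ZMod 2
  | .inl j, b => w j.2 j.1.1 b
  | .inr x, b => if h : b.1 < s then keyShare a P w x.1 c ⟨b.1, h⟩ else 0

/-- The bits of the message. -/
noncomputable def messageBit (P : Keys N C r t s) (d : User C r → Demand N)
    (w : Fin N → Subfile C t → Fin s → ZMod 2) :
    (j : MessageBlock N C r t) → Fin (messageBlockLength N C r t s j) → ZMod 2
  | .inl A, b => transmit P d w A b
  | .inr (g, i), _ => P.demandMask g i + d g i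

/-- The subfiles of a library. -/
def subfiles {F : ℕ} (e : Subfile C t × Fin s ≃ Fin F) (W : Library N F) :
    Fin N → Subfile C t → Fin s → ZMod 2 :=
  fun i T b => W i (e (T, b))

/-- The scheme with parameter `t`. -/
noncomputable def codedScheme {F m n : ℕ} (s' : ℕ) (a : User C r → Fin C)
    (e : Subfile C t × Fin s ≃ Fin F)
    (posCache : ∀ c : Fin C, (Σ j, Fin (cacheBlockLength N r t s s' c j)) ≃ Fin m)
    (posMessage : (Σ j, Fin (messageBlockLength N C r t s j)) ≃ Fin n) :
    CachingScheme N C r F m n where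
  Rand := Keys N C r t s
  place c P W k := cacheBit s' a c P (subfiles e W) ((posCache c).symm k).1 ((posCache c).symm k).2
  send P d W k := messageBit P d (subfiles e W) (posMessage.symm k).1 (posMessage.symm k).2

/-! ### Correctness, security and privacy of the coded scheme -/

section Perfect

variable {F m n s' : ℕ} {a : User C r → Fin C} {e : Subfile C t × Fin s ≃ Fin F}
  {posCache : ∀ c : Fin C, (Σ j, Fin (cacheBlockLength N r t s s' c j)) ≃ Fin m}
  {posMessage : (Σ j, Fin (messageBlockLength N C r t s j)) ≃ Fin n}

lemma codedScheme_place_eq_iff {c : Fin C} {P P' : Keys N C r t s} {W W' : Library N F} :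
    (codedScheme s' a e posCache posMessage).place c P W =
      (codedScheme s' a e posCache posMessage).place c P' W' ↔
    ∀ j b, cacheBit s' a c P (subfiles e W) j b = cacheBit s' a c P' (subfiles e W') j b := by
  constructor
  · intro h j b
    have h' : ∀ x : Σ j, Fin (cacheBlockLength N r t s s' c j),
        cacheBit s' a c P (subfiles e W) x.1 x.2 = cacheBit s' a c P' (subfiles e W') x.1 x.2 := by
      intro x
      obtain ⟨k, rfl⟩ := (posCache c).symm.surjective x
      exact congrFun h k
    exact h' ⟨j, b⟩
  · exact fun h => funext fun k => h _ _

lemma codedScheme_send_eq_iff {P P' : Keys N C r t s} {d d' : User C r → Demand N}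
    {W W' : Library N F} :
    (codedScheme s' a e posCache posMessage).send P d W =
      (codedScheme s' a e posCache posMessage).send P' d' W' ↔
    (∀ A b, transmit P d (subfiles e W) A b = transmit P' d' (subfiles e W') A b) ∧
      P.demandMask + d = P'.demandMask + d' := by
  have h : (codedScheme s' a e posCache posMessage).send P d W =
      (codedScheme s' a e posCache posMessage).send P' d' W' ↔
      ∀ j b, messageBit P d (subfiles e W) j b = messageBit P' d' (subfiles e W') j b := by
    constructor
    · intro h j b
      have h' : ∀ x : Σ j, Fin (messageBlockLength N C r t s j),
          messageBit P d (subfiles e W) x.1 x.2 = messageBit P' d' (subfiles e W') x.1 x.2 := by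
        intro x
        obtain ⟨k, rfl⟩ := posMessage.symm.surjective x
        exact congrFun h k
      exact h' ⟨j, b⟩
    · exact fun h => funext fun k => h _ _
  rw [h]
  constructor
  · exact fun h => ⟨fun A b => h (.inl A) b,
      funext fun g => funext fun i => h (.inr (g, i)) (0 : Fin 1)⟩
  · rintro ⟨h₁, h₂⟩ (A | ⟨g, i⟩) b
    · exact h₁ A b
    · exact congrFun (congrFun h₂ g) i

/-- The other caches of the user reveal the random shares that were subtracted from the key in the
designated cache. -/
lemma userKey_eq_of_keyShare_eq (ha : ∀ g, a g ∈ g.1) {P P' : Keys N C r t s}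
    {w w' : Fin N → Subfile C t → Fin s → ZMod 2} {x : Missing C r t} {b : Fin s}
    (h : ∀ c ∈ x.1.1.1, keyShare a P w x c b = keyShare a P' w' x c b) :
    userKey P w x b = userKey P' w' x b := by
  have h₀ := h (a x.1.1) (ha _)
  simp only [keyShare, if_true] at h₀
  have h₁ : ∑ c ∈ x.1.1.1.erase (a x.1.1), P.share x c b =
      ∑ c ∈ x.1.1.1.erase (a x.1.1), P'.share x c b := by
    refine Finset.sum_congr rfl fun c hc => ?_
    obtain ⟨hne, hc⟩ := Finset.mem_erase.1 hc
    simpa [keyShare, hne] using h c hc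
  rw [h₁] at h₀
  exact sub_left_injective h₀

/-- A user obtains its linear combination of a missing subfile. -/
lemma subfileComb_eq_of_transmit_eq {P P' : Keys N C r t s} {d d' : User C r → Demand N}
    {w w' : Fin N → Subfile C t → Fin s → ZMod 2} {x : Missing C r t} {b : Fin s}
    (hX : transmit P d w x.transmission b = transmit P' d' w' x.transmission b)
    (hq : P.demandMask + d = P'.demandMask + d')
    (hkey : userKey P w x b = userKey P' w' x b)
    (hw : ∀ i (T : Subfile C t), ¬ Disjoint x.1.1.1 T.1 → w i T b = w' i T b) :
    subfileComb w (d x.1.1) x.1.2 b = subfileComb w' (d' x.1.1) x.1.2 b := by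
  classical
  have hx : x ∈ Finset.univ.filter fun y : Missing C r t => y.transmission = x.transmission := by
    simp
  have hrest : ∀ y ∈ (Finset.univ.filter fun y : Missing C r t =>
      y.transmission = x.transmission).erase x,
      subfileComb w (P.demandMask y.1.1 + d y.1.1) y.1.2 b =
        subfileComb w' (P'.demandMask y.1.1 + d' y.1.1) y.1.2 b := by
    intro y hy
    simp only [Finset.mem_erase, Finset.mem_filter, Finset.mem_univ, true_and] at hy
    -- Every other term of this transmission involves a subfile that meets the user's caches, hence
    -- is known.
    have hdis : ¬ Disjoint x.1.1.1 y.1.2.1 := fun hdis =>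
      hy.1 (Missing.eq_of_union_eq (congrArg Subtype.val hy.2).symm hdis).symm
    have hqy : P.demandMask y.1.1 + d y.1.1 = P'.demandMask y.1.1 + d' y.1.1 := congrFun hq y.1.1
    rw [hqy]
    exact Finset.sum_congr rfl fun i _ => by rw [hw i _ hdis]
  unfold transmit at hX
  rw [← Finset.add_sum_erase _ _ hx, ← Finset.add_sum_erase _ _ hx, Finset.sum_congr rfl hrest,
    subfileComb_add, subfileComb_add] at hX
  unfold userKey at hkey
  linear_combination hX - hkey

/-- Changing the masks of the demands of the other users changes their keys; one cache that the user
`g` does not read absorbs the change. -/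
lemma exists_keyShare_eq (g : User C r) (w : Fin N → Subfile C t → Fin s → ZMod 2)
    (δ : User C r → Demand N) (hδ : δ g = 0) :
    ∃ y : Missing C r t → Fin C → Fin s → ZMod 2, ∀ (P : Keys N C r t s) (x : Missing C r t),
      ∀ c ∈ g.1, c ∈ x.1.1.1 → ∀ b,
        keyShare a (Keys.translate ⟨0, y, δ⟩ P) w x c b = keyShare a P w x c b := by
  classical
  -- Distinct sets of the same size r are not contained in one another.
  have hout : ∀ h : User C r, h ≠ g → ∃ c ∈ h.1, c ∉ g.1 := by
    intro h hne
    by_contra! hsub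
    exact hne (Subtype.ext (Finset.eq_of_subset_of_card_le hsub (by rw [h.2, g.2])))
  have : Nonempty (Fin C) := ⟨a g⟩
  choose! o ho hog using hout
  -- The share at `o h`, outside g, takes up the change of the key. If `o h` is the designated
  -- cache, its random share is never used and the change falls on its computed share, unseen by g.
  refine ⟨fun x c b => if x.1.1 ≠ g ∧ c = o x.1.1 then subfileComb w (δ x.1.1) x.1.2 b else 0,
    fun P x c hcg hcx b => ?_⟩
  by_cases hx : x.1.1 = g
  · simp [keyShare, Keys.translate_apply, userKey, Missing.transmission, hx, hδ]
  · have hco : c ≠ o x.1.1 := fun h => hog _ hx (h ▸ hcg)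
    have hmem : o x.1.1 ∈ x.1.1.1.erase c := Finset.mem_erase.2 ⟨hco.symm, ho _ hx⟩
    simp [keyShare, Keys.translate_apply, userKey, hx, hco, Finset.sum_add_distrib, hmem,
      subfileComb_add]
    split_ifs <;> abel

/-- Decoding treats cached and missing subfiles separately. The library is hidden by shifting the
transmission masks, the demands by shifting the demand masks and the shares. -/
lemma isPerfect_codedScheme (hs : s ≤ s') (ha : ∀ g, a g ∈ g.1) :
    (codedScheme s' a e posCache posMessage).IsPerfect where
  decodes g P P' d d' W W' hX hd hZ := by
    obtain ⟨hX, hq⟩ := codedScheme_send_eq_iff.1 hX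
    replace hZ := fun c hc => codedScheme_place_eq_iff.1 (hZ c hc)
    have hw : ∀ i (T : Subfile C t), ¬ Disjoint g.1 T.1 → ∀ b,
        subfiles e W i T b = subfiles e W' i T b := by
      intro i T hT b
      obtain ⟨c, hcg, hcT⟩ := Finset.not_disjoint_iff.1 hT
      exact hZ c hcg (.inl (⟨T, hcT⟩, i)) b
    have hcomb : ∀ T b, subfileComb (subfiles e W) (d g) T b =
        subfileComb (subfiles e W') (d' g) T b := by
      intro T b
      by_cases hT : Disjoint g.1 T.1
      -- Since `s ≤ s'`, padding keeps all s bits of a share.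
      · have hkey := userKey_eq_of_keyShare_eq (P := P) (P' := P') (w := subfiles e W)
          (w' := subfiles e W') (x := ⟨(g, T), hT⟩) (b := b) ha fun c hc => by
            simpa [cacheBit] using hZ c hc (.inr ⟨⟨(g, T), hT⟩, hc⟩) ⟨b.1, b.2.trans_le hs⟩
        exact subfileComb_eq_of_transmit_eq (hX _ b) hq hkey fun i T hT => hw i T hT b
      · unfold subfileComb
        rw [hd]
        exact Finset.sum_congr rfl fun i _ => by rw [hw i T hT b]
    funext k
    obtain ⟨⟨T, b⟩, rfl⟩ := e.surjective k
    rw [linComb_apply, linComb_apply]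
    exact hcomb T b
  hidesLibrary d W W' := by
    classical
    -- The part of a transmission that involves the library. It depends on `P` only through
    -- `demandMask`, which `σ` leaves alone; this makes `σ` invertible.
    let q (P : Keys N C r t s) (w : Fin N → Subfile C t → Fin s → ZMod 2)
        (A : Subfile C (t + r)) (b : Fin s) : ZMod 2 :=
      ∑ x : Missing C r t with x.transmission = A,
        subfileComb w (P.demandMask x.1.1 + d x.1.1) x.1.2 b
    have hcancel : ∀ P w A b, transmit P d w A b = P.mask A b + q P w A b := fun _ _ _ _ => rfl
    let σ : Equiv.Perm (Keys N C r t s) :=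
      { toFun P := ⟨P.mask + q P (subfiles e W) - q P (subfiles e W'), P.share, P.demandMask⟩
        invFun P := ⟨P.mask - q P (subfiles e W) + q P (subfiles e W'), P.share, P.demandMask⟩
        left_inv P := by
          ext
          · simp only [q, Pi.add_apply, Pi.sub_apply]
            ring
          · rfl
          · rfl
        right_inv P := by
          ext
          · simp only [q, Pi.add_apply, Pi.sub_apply]
            ring
          · rfl
          · rfl }
    have hσ : ∀ (P : Keys N C r t s) A b,
        transmit (σ P) d (subfiles e W') A b = transmit P d (subfiles e W) A b := fun P A b => by
      rw [hcancel, hcancel]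
      change (P.mask + q P (subfiles e W) - q P (subfiles e W')) A b + q P (subfiles e W') A b = _
      simp only [Pi.add_apply, Pi.sub_apply]
      ring
    exact ⟨σ, fun P => codedScheme_send_eq_iff.2 ⟨hσ P, rfl⟩⟩
  hidesDemands g W d d' hd := by
    -- The shift `d - d'` keeps every masked demand, hence every transmission; it vanishes at g.
    obtain ⟨y, hy⟩ := exists_keyShare_eq (a := a) g (subfiles e W) (d - d') (by simp [hd])
    refine ⟨Keys.translate ⟨0, y, d - d'⟩, fun (P : Keys N C r t s) => ⟨?_, fun c hc => ?_⟩⟩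
    · have hq : (Keys.translate ⟨0, y, d - d'⟩ P).demandMask + d' = P.demandMask + d := by
        simp [Keys.translate_apply, add_assoc]
      refine codedScheme_send_eq_iff.2 ⟨fun A b => ?_, hq⟩
      have hmask : (Keys.translate ⟨0, y, d - d'⟩ P).mask = P.mask := by
        simp [Keys.translate_apply]
      refine congrArg₂ (· + ·) (congrFun (congrFun hmask A) b) (Finset.sum_congr rfl fun x _ => ?_)
      exact congrArg (fun p => subfileComb (subfiles e W) p x.1.2 b) (congrFun hq x.1.1)
    · refine codedScheme_place_eq_iff.2 ?_
      rintro (j | x) b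
      · rfl
      · simp only [cacheBit]
        split_ifs with hb
        · exact hy P x.1 c hc x.2 _
        · rfl

end Perfect

end MultiAccess

/-- Among the shares, only those in designated caches involve the library, with coefficients from
the demand masks; the remaining terms, and the padding, go into the key of the block. -/
lemma codedScheme_hasSubpacketization {N C r t s s' L F m n : ℕ} (a : User C r → Fin C)
    (eτ : Subfile C t ≃ Fin L) (e : Fin L × Fin s ≃ Fin F)
    (posCache : ∀ c : Fin C, (Σ j, Fin (cacheBlockLength N r t s s' c j)) ≃ Fin m)
    (posMessage : (Σ j, Fin (messageBlockLength N C r t s j)) ≃ Fin n) :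
    (codedScheme s' a ((eτ.prodCongr (Equiv.refl (Fin s))).trans e) posCache
      posMessage).HasSubpacketization L := by
  classical
  refine ⟨s, e, fun c => ?_, ?_⟩
  · refine operatesOnSubfiles_of_blocks eτ e _ (cacheBlockLength N r t s s' c) (posCache c)
      (fun (P : Keys N C r t s) j => match j with
        | .inl _ => fun _ => 0
        | .inr x => fun b => if h : b.1 < s then
            if c = a x.1.1.1 then P.mask x.1.transmission ⟨b.1, h⟩ -
              ∑ c' ∈ x.1.1.1.1.erase c, P.share x.1 c' ⟨b.1, h⟩
            else P.share x.1 c ⟨b.1, h⟩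
          else 0)
      (fun (P : Keys N C r t s) j i u => match j with
        | .inl y => if u = y.1.1 then if i = y.2 then 1 else 0 else 0
        | .inr x => if u = x.1.1.2 then if c = a x.1.1.1 then P.demandMask x.1.1.1 i else 0 else 0)
      ?_
    intro (P : Keys N C r t s) W j b
    have hbit : (codedScheme s' a ((eτ.prodCongr (Equiv.refl (Fin s))).trans e) posCache
        posMessage).place c P W (posCache c ⟨j, b⟩) =
        cacheBit s' a c P (subfiles ((eτ.prodCongr (Equiv.refl (Fin s))).trans e) W) j b := by
      simp only [codedScheme]
      rw [Equiv.symm_apply_apply]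
    refine hbit.trans ?_
    rcases j with y | x
    · have hb : b.1 < s := b.2
      simp [cacheBit, subfiles, hb]
      rfl
    · by_cases hb : b.1 < s
      · by_cases hc : c = a x.1.1.1
        · simp [cacheBit, subfiles, keyShare, userKey, subfileComb, hb, hc]
          ring
        · simp [cacheBit, keyShare, hb, hc]
      · simp [cacheBit, hb]
  · refine operatesOnSubfiles_of_blocks eτ e _ (messageBlockLength N C r t s) posMessage
      (fun (x : Keys N C r t s × (User C r → Demand N)) j => match j with
        | .inl A => fun b => x.1.mask A b
        | .inr y => fun _ => x.1.demandMask y.1 y.2 + x.2 y.1 y.2)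
      (fun (x : Keys N C r t s × (User C r → Demand N)) j i u => match j with
        -- At most one term is nonzero, since A and T determine the user A \ T.
        | .inl A => ∑ y : Missing C r t with y.transmission = A,
            if u = y.1.2 then (x.1.demandMask y.1.1 + x.2 y.1.1) i else 0
        | .inr _ => 0) ?_
    intro (x : Keys N C r t s × (User C r → Demand N)) W j b
    have hbit : (codedScheme s' a ((eτ.prodCongr (Equiv.refl (Fin s))).trans e) posCache
        posMessage).send x.1 x.2 W (posMessage ⟨j, b⟩) =
        messageBit x.1 x.2 (subfiles ((eτ.prodCongr (Equiv.refl (Fin s))).trans e) W) j b := by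
      simp only [codedScheme]
      rw [Equiv.symm_apply_apply]
    refine hbit.trans ?_
    rcases j with A | y
    · have hb : b.1 < s := b.2
      simp only [messageBit, transmit, subfileComb, hb, dif_pos, Finset.sum_mul]
      congr 1
      simp only [Finset.sum_comm (t := Finset.univ.filter fun y : Missing C r t =>
        y.transmission = A), ite_mul, zero_mul, Finset.sum_ite_eq', Finset.mem_univ, if_true]
      rfl
    · simp [messageBit]

/-! ### Counting the bits of caches and message -/

section Cardinalities

variable {C : ℕ}

lemma card_subfile_disjoint (t : ℕ) (A : Finset (Fin C)) :
    Nat.card {T : Subfile C t // Disjoint A T.1} = (C - A.card).choose t := by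
  classical
  have e : {T : Subfile C t // Disjoint A T.1} ≃ {T // T ∈ Finset.powersetCard t Aᶜ} :=
    (Equiv.subtypeSubtypeEquivSubtypeInter _ fun T => Disjoint A T).trans
      (Equiv.subtypeEquivRight fun T => by
        rw [Finset.mem_powersetCard, Finset.subset_compl_iff_disjoint_left, and_comm])
  rw [Nat.card_congr e, Nat.card_eq_fintype_card, Fintype.card_coe, Finset.card_powersetCard,
    Finset.card_compl, Fintype.card_fin]

/-- The number of `t`-subsets that contain a given element. -/
lemma card_subfile_mem (t : ℕ) (c : Fin C) :
    Nat.card {T : Subfile C t // c ∈ T.1} = C.choose t - (C - 1).choose t := by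
  classical
  have h := card_subfile_disjoint t {c}
  simp only [Finset.disjoint_singleton_left, Finset.card_singleton] at h
  have h' := Fintype.card_subtype_compl fun T : Subfile C t => c ∈ T.1
  rw [Nat.card_eq_fintype_card] at h ⊢
  have hle := Fintype.card_subtype_le fun T : Subfile C t => c ∈ T.1
  rw [Fintype.card_finset_len, Fintype.card_fin] at h' hle
  omega

lemma card_missing_mem {r : ℕ} (hr : 1 ≤ r) (t : ℕ) (c : Fin C) :
    Nat.card {x : Missing C r t // c ∈ x.1.1.1} =
      (C - r).choose t * (C - 1).choose (r - 1) := by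
  classical
  let e : {x : Missing C r t // c ∈ x.1.1.1} ≃
      Σ h : {h : User C r // c ∈ h.1}, {T : Subfile C t // Disjoint h.1.1 T.1} :=
    { toFun x := ⟨⟨x.1.1.1, x.2⟩, ⟨x.1.1.2, x.1.2⟩⟩
      invFun y := ⟨⟨(y.1.1, y.2.1), y.2.2⟩, y.1.2⟩
      left_inv _ := rfl
      right_inv _ := rfl }
  have hC : 0 < C := c.pos
  -- Pascal's rule, to evaluate the truncated subtraction in `card_subfile_mem`.
  have hsum : (C - 1).choose (r - 1) + (C - 1).choose r = C.choose r := by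
    obtain ⟨k, rfl⟩ := Nat.exists_eq_add_of_le' hr
    obtain ⟨n, rfl⟩ := Nat.exists_eq_add_of_le' hC
    exact (Nat.choose_succ_succ n k).symm
  rw [Nat.card_congr e, Nat.card_sigma]
  simp only [card_subfile_disjoint]
  rw [Finset.sum_congr rfl fun h _ => by rw [h.1.2], Finset.sum_const, smul_eq_mul, mul_comm,
    Finset.card_univ, ← Nat.card_eq_fintype_card, card_subfile_mem r c]
  congr 1
  omega

lemma card_cacheBits {N r t s s' : ℕ} (hr : 1 ≤ r) (c : Fin C) :
    Nat.card (Σ j, Fin (cacheBlockLength N r t s s' c j)) =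
      (C.choose t - (C - 1).choose t) * N * s +
        (C - r).choose t * (C - 1).choose (r - 1) * s' := by
  classical
  rw [Nat.card_sigma, Fintype.sum_sum_type]
  simp only [cacheBlockLength, Nat.card_fin, Finset.sum_const, smul_eq_mul, Finset.card_univ,
    ← Nat.card_eq_fintype_card, Nat.card_prod, card_subfile_mem, card_missing_mem hr]

lemma card_messageBits {N r t s : ℕ} :
    Nat.card (Σ j, Fin (messageBlockLength N C r t s j)) =
      C.choose (t + r) * s + C.choose r * N := by
  classical
  rw [Nat.card_sigma, Fintype.sum_sum_type]
  simp [messageBlockLength]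

end Cardinalities

/-- The scheme with parameter `t`, for subfiles of `s` bits and key shares of `s'` bits. -/
theorem exists_codedScheme {N C r : ℕ} (hr : 1 ≤ r) (t : ℕ) {s s' : ℕ} (hs : s ≤ s') :
    ∃ S : CachingScheme N C r (C.choose t * s)
      ((C.choose t - (C - 1).choose t) * N * s + (C - r).choose t * (C - 1).choose (r - 1) * s')
      (C.choose (t + r) * s + C.choose r * N),
      S.IsPerfect ∧ S.HasSubpacketization (C.choose t) := by
  classical
  have hne : ∀ g : User C r, ∃ c, c ∈ g.1 := fun g => Finset.card_pos.1 (by rw [g.2]; exact hr)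
  choose a ha using hne
  have eτ : Subfile C t ≃ Fin (C.choose t) := Fintype.equivFinOfCardEq (by simp)
  have posCache := fun c : Fin C => Finite.equivFinOfCardEq
    (card_cacheBits (N := N) (t := t) (s := s) (s' := s') hr c)
  have posMessage := Finite.equivFinOfCardEq (card_messageBits (C := C) (N := N) (r := r) (t := t)
    (s := s))
  exact ⟨codedScheme s' a ((eτ.prodCongr (Equiv.refl (Fin s))).trans finProdFinEquiv) posCache
    posMessage, isPerfect_codedScheme hs ha, codedScheme_hasSubpacketization _ _ _ _ _⟩

/-! ### Memory, rate and the convex envelope -/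

lemma fieldDegree_pos (r : ℕ) : 0 < fieldDegree r := by
  have h : ({l : ℕ | 0 < l ∧ r < 2 ^ l}).Nonempty :=
    ⟨r + 1, r.succ_pos, (Nat.lt_two_pow_self).trans (Nat.pow_lt_pow_right one_lt_two r.lt_succ_self)⟩
  exact (Nat.sInf_mem h).1

/-- The memory of the scheme with parameter `t` when the shares are not padded. -/
noncomputable def unpaddedMemory (N C r t : ℕ) : ℝ :=
  (N : ℝ) * t / C + ((C - r).choose t : ℝ) * ((C - 1).choose (r - 1) : ℝ) / (C.choose t : ℝ)

/-- Each cache holds the fraction t/C of the subfiles. This is the identity (n+1)·binom(n,t) =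
(n+1-t)·binom(n+1,t) with C = n+1. -/
lemma cast_choose_sub_choose_pred {C : ℕ} (hC : 0 < C) (t : ℕ) (ht : t ≤ C) :
    ((C.choose t - (C - 1).choose t : ℕ) : ℝ) = (C.choose t : ℝ) * t / C := by
  obtain ⟨n, rfl⟩ := Nat.exists_eq_add_of_le' hC
  have h := congrArg (Nat.cast (R := ℝ)) (Nat.choose_mul_succ_eq n t)
  push_cast [Nat.cast_sub ht] at h
  rw [Nat.add_sub_cancel, Nat.cast_sub (Nat.choose_le_choose t n.le_succ),
    eq_div_iff (by positivity)]
  push_cast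
  linear_combination -h

/-- The numbers of bits of the scheme with parameter `t`. -/
lemma coded_memory_eq {N C r t s s' : ℕ} (hC : 0 < C) (ht : t ≤ C) :
    (((C.choose t - (C - 1).choose t) * N * s + (C - r).choose t * (C - 1).choose (r - 1) * s' : ℕ)
      : ℝ) = (N : ℝ) * t / C * (C.choose t * s) +
        (C - r).choose t * (C - 1).choose (r - 1) * s' := by
  push_cast
  rw [cast_choose_sub_choose_pred hC t ht]
  ring

lemma rateSP_mul {C r t s : ℕ} (ht : t ≤ C) :
    rateSP C r t * (C.choose t * s) = (C.choose (t + r) : ℝ) * s := by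
  have : (C.choose t : ℝ) ≠ 0 := by exact_mod_cast (Nat.choose_pos ht).ne'
  rw [rateSP]
  field_simp

lemma memorySP_mul {N C r t s : ℕ} (ht : t ≤ C) (hs : 0 < s) :
    memorySP N C r (C.choose t * s) t * (C.choose t * s) = (N : ℝ) * t / C * (C.choose t * s) +
      (C - r).choose t * (C - 1).choose (r - 1) * (⌈(s : ℝ) / fieldDegree r⌉₊ * fieldDegree r) := by
  have hL : (C.choose t : ℝ) ≠ 0 := by exact_mod_cast (Nat.choose_pos ht).ne'
  have hs' : (s : ℝ) ≠ 0 := by exact_mod_cast hs.ne'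
  have hdiv : ((C.choose t * s : ℕ) : ℝ) / (fieldDegree r * C.choose t) = s / fieldDegree r := by
    push_cast
    rw [mul_comm (fieldDegree r : ℝ), mul_div_mul_left _ _ hL]
  rw [memorySP, hdiv, add_mul]
  congr 1
  push_cast
  field_simp

lemma unpaddedMemory_le_memorySP {N C r F t : ℕ} (ht : t ≤ C) (hF : 0 < F) :
    unpaddedMemory N C r t ≤ memorySP N C r F t := by
  have hL : (0 : ℝ) < C.choose t := by exact_mod_cast Nat.choose_pos ht
  have hF' : (0 : ℝ) < F := by exact_mod_cast hF
  have hl : (0 : ℝ) < fieldDegree r := by exact_mod_cast fieldDegree_pos r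
  have h : 1 / (C.choose t : ℝ) ≤
      ⌈(F : ℝ) / (fieldDegree r * C.choose t)⌉₊ * ((fieldDegree r : ℝ) / F) := by
    have h := mul_le_mul_of_nonneg_right (Nat.le_ceil ((F : ℝ) / (fieldDegree r * C.choose t)))
      (div_pos hl hF').le
    refine le_trans (le_of_eq ?_) h
    field_simp
  rw [unpaddedMemory, memorySP, mul_assoc _ (Nat.cast ⌈_⌉₊) (_ / _),
    div_eq_mul_one_div _ (C.choose t : ℝ)]
  gcongr

/-- Memory sharing between the points `(μ i, ρ i)` with weights that are multiples of `1 / Q`: the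
memory does not grow, and the rate grows by a bounded number of parts only. -/
lemma exists_rounded_weights {ι : Type*} [Fintype ι] [Nonempty ι] (μ ρ w : ι → ℝ)
    (hρ : ∀ i, 0 ≤ ρ i) (hw : ∀ i, 0 ≤ w i) (hw1 : ∑ i, w i = 1) (Q : ℕ) :
    ∃ k : ι → ℕ, ∑ i, k i = Q ∧ ∑ i, μ i * k i ≤ (∑ i, w i * μ i) * Q ∧
      ∑ i, ρ i * k i ≤ (∑ i, w i * ρ i) * Q + Fintype.card ι * ∑ i, ρ i := by
  classical
  obtain ⟨i₀, hi₀⟩ := Finite.exists_min μ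
  have hfl : ∀ i, (⌊w i * Q⌋₊ : ℝ) ≤ w i * Q := fun i =>
    Nat.floor_le (mul_nonneg (hw i) Q.cast_nonneg)
  have hsum : ∑ i, w i * Q = (Q : ℝ) := by rw [← Finset.sum_mul, hw1, one_mul]
  have hle : ∑ i, ⌊w i * Q⌋₊ ≤ Q := by
    have := Finset.sum_le_sum fun i (_ : i ∈ Finset.univ) => hfl i
    rw [hsum] at this
    exact_mod_cast this
  -- The `δ` parts lost by rounding down all go to `i₀`, the point of least memory.
  obtain ⟨δ, hδ⟩ := Nat.exists_eq_add_of_le hle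
  have hδ' : (δ : ℝ) = ∑ i, (w i * Q - ⌊w i * Q⌋₊) := by
    rw [Finset.sum_sub_distrib, hsum]
    have := congrArg (Nat.cast (R := ℝ)) hδ
    push_cast at this
    linarith
  have hδc : (δ : ℝ) ≤ Fintype.card ι := by
    rw [hδ']
    refine (Finset.sum_le_sum (g := fun _ => (1 : ℝ)) fun i _ => ?_).trans (by simp)
    linarith [Nat.lt_floor_add_one (w i * Q)]
  have hcomb : ∀ f : ι → ℝ, ∑ i, f i * ((⌊w i * Q⌋₊ + if i = i₀ then δ else 0 : ℕ) : ℝ) =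
      ∑ i, f i * ⌊w i * Q⌋₊ + f i₀ * δ := fun f => by
    simp [mul_add, Finset.sum_add_distrib]
  refine ⟨fun i => ⌊w i * Q⌋₊ + if i = i₀ then δ else 0, ?_, ?_, ?_⟩
  · simp [Finset.sum_add_distrib, ← hδ]
  · rw [hcomb, hδ', Finset.mul_sum, ← Finset.sum_add_distrib, Finset.sum_mul]
    refine Finset.sum_le_sum fun i _ => ?_
    -- Each fractional part costs `μ i₀` instead of `μ i`, which is no more.
    nlinarith [mul_nonneg (sub_nonneg.2 (hi₀ i)) (sub_nonneg.2 (hfl i))]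
  · rw [hcomb]
    refine add_le_add ?_ ?_
    · rw [Finset.sum_mul]
      refine Finset.sum_le_sum fun i _ => ?_
      nlinarith [mul_le_mul_of_nonneg_left (hfl i) (hρ i)]
    · rw [mul_comm]
      exact mul_le_mul hδc (Finset.single_le_sum (fun i _ => hρ i) (Finset.mem_univ _)) (hρ _)
        (Nat.cast_nonneg _)

/-- The linear image of the standard simplex is convex and contains every `v i`. -/
lemma exists_weights_of_mem_convexHull_range {ι E : Type*} [Fintype ι] [AddCommGroup E] [Module ℝ E]
    {v : ι → E} {p : E} (hp : p ∈ convexHull ℝ (Set.range v)) :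
    ∃ w : ι → ℝ, (∀ i, 0 ≤ w i) ∧ ∑ i, w i = 1 ∧ ∑ i, w i • v i = p := by
  classical
  have hconv := (convex_stdSimplex ℝ ι).linear_image (Fintype.linearCombination ℝ v)
  obtain ⟨w, hw, rfl⟩ := convexHull_min (s := Set.range v) (by
    rintro _ ⟨i, rfl⟩
    exact ⟨Pi.single i 1, single_mem_stdSimplex ℝ i, by simp⟩) hconv hp
  exact ⟨w, hw.1, hw.2, rfl⟩

/-- The achieved pairs: one for each `t ≤ C - r`, and `(N, 0)`. -/
noncomputable def sharedPoint (N C r : ℕ) (f : ℕ → ℝ) : Option (Fin (C - r + 1)) → ℝ × ℝ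
  | none => (N, 0)
  | some t => (f t, rateSP C r t)

lemma pointsSP_eq_range (N C r F : ℕ) :
    pointsSP N C r F = Set.range (sharedPoint N C r (memorySP N C r F)) := by
  ext p
  simp only [pointsSP, Set.mem_union, Set.mem_ofPred_eq, Set.mem_singleton_iff, Set.mem_range]
  constructor
  · rintro (⟨t, ht, rfl⟩ | rfl)
    · exact ⟨some ⟨t, Nat.lt_succ_of_le ht⟩, rfl⟩
    · exact ⟨none, rfl⟩
  · rintro ⟨_ | t, rfl⟩
    · exact Or.inr rfl
    · exact Or.inl ⟨t, Nat.le_of_lt_succ t.2, rfl⟩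

lemma rateSP_nonneg (C r t : ℕ) : 0 ≤ rateSP C r t := by
  unfold rateSP
  positivity

/-- Each point is achieved by perfect schemes for all file lengths that its subpacketization
divides. -/
lemma exists_perfectlyAchievable {N C r : ℕ} (hr : 1 ≤ r) (hrC : r ≤ C)
    (i : Option (Fin (C - r + 1))) (F : ℕ) (hF : ∀ t ≤ C - r, C.choose t ∣ F) :
    ∃ m n : ℕ, PerfectlyAchievable N C r F m n ∧
      (m : ℝ) = (sharedPoint N C r (unpaddedMemory N C r) i).1 * F ∧
      (n : ℝ) ≤ (sharedPoint N C r (unpaddedMemory N C r) i).2 * F + C.choose r * N := by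
  rcases i with _ | t
  · refine ⟨_, _, .uncoded F hr, ?_, ?_⟩
    · simp [sharedPoint]
    · simp only [sharedPoint, Nat.cast_zero, zero_mul, zero_add]
      positivity
  · have ht : t.1 ≤ C := by omega
    obtain ⟨s, rfl⟩ := hF t.1 (Nat.le_of_lt_succ t.2)
    -- Shares of length `s' = s`: without padding the memory is exactly proportional to the file
    -- length, also for the short pieces used in memory sharing.
    obtain ⟨S, hS, -⟩ := exists_codedScheme (N := N) (C := C) hr t.1 le_rfl (s := s)
    have hL : (C.choose t : ℝ) ≠ 0 := by exact_mod_cast (Nat.choose_pos ht).ne'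
    refine ⟨_, _, ⟨S, hS⟩, ?_, ?_⟩
    · rw [coded_memory_eq (by omega) ht, sharedPoint, unpaddedMemory]
      push_cast
      rw [add_mul]
      congr 1
      field_simp
    · simp only [sharedPoint]
      push_cast
      rw [rateSP_mul ht]

lemma exists_isSPLFR_of_mem_convexHull {N C r : ℕ} (hr : 1 ≤ r) (hrC : r ≤ C) :
    ∃ κ : ℝ, ∀ F : ℕ, 0 < F → (∀ t : ℕ, t ≤ C - r → C.choose t ∣ F) →
      ∀ p ∈ convexHull ℝ (pointsSP N C r F),
        ∃ m n : ℕ, (m : ℝ) ≤ p.1 * F ∧ (n : ℝ) ≤ p.2 * F + κ ∧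
          ∃ S : CachingScheme N C r F m n, S.IsSPLFR := by
  classical
  set D : ℕ := (Finset.range (C - r + 1)).lcm C.choose
  have hdvd : ∀ t ≤ C - r, C.choose t ∣ D := fun t ht =>
    Finset.dvd_lcm (Finset.mem_range.2 (Nat.lt_succ_of_le ht))
  set v := sharedPoint N C r (unpaddedMemory N C r) with hv
  set c : ℝ := (Fintype.card (Option (Fin (C - r + 1))) : ℝ)
  -- The first term pays for the rounded chunks of D bits, the second for one copy of the masked
  -- demands per point.
  refine ⟨D * (c * ∑ i, (v i).2) + c * (C.choose r * N), fun F hF hdF p hp => ?_⟩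
  obtain ⟨Q, rfl⟩ : D ∣ F := Finset.lcm_dvd fun t ht =>
    hdF t (Nat.le_of_lt_succ (Finset.mem_range.1 ht))
  rw [pointsSP_eq_range] at hp
  obtain ⟨w, hw, hw1, rfl⟩ := exists_weights_of_mem_convexHull_range hp
  have hρ : ∀ i, 0 ≤ (v i).2 := by
    rintro (_ | t)
    · exact le_rfl
    · exact rateSP_nonneg C r t
  obtain ⟨k, hk, hmem, hrate⟩ := exists_rounded_weights (fun i => (v i).1) (fun i => (v i).2) w hρ hw
    hw1 Q
  choose m n hach hm hn using fun i => exists_perfectlyAchievable (N := N) hr hrC i (D * k i)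
    fun t ht => (hdvd t ht).mul_right _
  obtain ⟨S, hS⟩ : PerfectlyAchievable N C r (D * Q) (∑ i, m i) (∑ i, n i) := by
    have := PerfectlyAchievable.sum hr Finset.univ (fun i => D * k i) m n fun i _ => hach i
    rwa [← Finset.mul_sum, hk] at this
  refine ⟨_, _, ?_, ?_, S, hS.isSPLFR⟩
  · have hle : ∑ i, w i * (v i).1 ≤
        (∑ i, w i • sharedPoint N C r (memorySP N C r (D * Q)) i).1 := by
      rw [Prod.fst_sum]
      refine Finset.sum_le_sum fun i _ => mul_le_mul_of_nonneg_left ?_ (hw i)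
      rcases i with _ | t
      · exact le_rfl
      · exact unpaddedMemory_le_memorySP (by omega) hF
    calc ((∑ i, m i : ℕ) : ℝ) = D * ∑ i, (v i).1 * k i := by
          push_cast
          rw [Finset.mul_sum]
          refine Finset.sum_congr rfl fun i _ => ?_
          rw [hm, hv]
          push_cast
          ring
      _ ≤ D * ((∑ i, w i * (v i).1) * Q) := by gcongr
      _ ≤ D * ((∑ i, w i • sharedPoint N C r (memorySP N C r (D * Q)) i).1 * Q) := by gcongr
      _ = _ := by
          push_cast
          ring
  -- Padding changes memories only, not rates.
  · have heq : (∑ i, w i • sharedPoint N C r (memorySP N C r (D * Q)) i).2 =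
        ∑ i, w i * (v i).2 := by
      rw [Prod.snd_sum]
      refine Finset.sum_congr rfl fun i _ => ?_
      rcases i with _ | t <;> rfl
    rw [heq]
    calc ((∑ i, n i : ℕ) : ℝ) ≤ ∑ i, ((v i).2 * (D * k i : ℕ) + C.choose r * N) := by
          push_cast
          refine Finset.sum_le_sum fun i _ => ?_
          have := hn i
          push_cast at this
          exact this
      _ = D * (∑ i, (v i).2 * k i) + c * (C.choose r * N) := by
          rw [Finset.sum_add_distrib, Finset.mul_sum, Finset.sum_const, nsmul_eq_mul,
            Finset.card_univ]
          congr 1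
          refine Finset.sum_congr rfl fun i _ => ?_
          push_cast
          ring
      _ ≤ D * ((∑ i, w i * (v i).2) * Q + c * ∑ i, (v i).2) + c * (C.choose r * N) := by gcongr
      _ = _ := by
          push_cast
          ring

theorem theorem1 (N C r : ℕ) (hr : 1 ≤ r) (hrC : r ≤ C) :
    (∀ t : ℕ, t ≤ C - r → ∀ F : ℕ, 0 < F → C.choose t ∣ F →
      ∃ m n : ℕ, (m : ℝ) = memorySP N C r F t * F ∧
        (n : ℝ) = rateSP C r t * F + (C.choose r : ℝ) * N ∧
        ∃ S : CachingScheme N C r F m n, S.IsSPLFR ∧ S.HasSubpacketization (C.choose t)) ∧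
    (∀ F : ℕ, 0 < F → ∃ S : CachingScheme N C r F (N * F) 0, S.IsSPLFR) ∧
    (∃ κ : ℝ, ∀ F : ℕ, 0 < F → (∀ t : ℕ, t ≤ C - r → C.choose t ∣ F) →
      ∀ M R : ℝ, (M, R) ∈ lowerConvexEnvelope (pointsSP N C r F) →
        ∃ m n : ℕ, (m : ℝ) ≤ M * F ∧ (n : ℝ) ≤ R * F + κ ∧
          ∃ S : CachingScheme N C r F m n, S.IsSPLFR) := by
  refine ⟨fun t ht F hF hdvd => ?_, fun F _ =>
    ⟨_, (CachingScheme.isPerfect_uncoded F hr).isSPLFR⟩, ?_⟩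
  · obtain ⟨s, rfl⟩ := hdvd
    have htC : t ≤ C := by omega
    have hs : 0 < s := Nat.pos_of_mul_pos_left hF
    have hl : (0 : ℝ) < fieldDegree r := by exact_mod_cast fieldDegree_pos r
    -- Shares are padded to the next multiple of l, as the ceiling in M_t(F) demands.
    have hs' : s ≤ ⌈(s : ℝ) / fieldDegree r⌉₊ * fieldDegree r := by
      have := (div_le_iff₀ hl).1 (Nat.le_ceil ((s : ℝ) / fieldDegree r))
      exact_mod_cast this
    obtain ⟨S, hS, hsub⟩ := exists_codedScheme (N := N) (C := C) hr t hs'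
    refine ⟨_, _, ?_, ?_, S, hS.isSPLFR, hsub⟩
    · rw [coded_memory_eq (by omega) htC]
      push_cast
      rw [memorySP_mul htC hs]
    · push_cast
      rw [rateSP_mul htC]
  · obtain ⟨κ, hκ⟩ := exists_isSPLFR_of_mem_convexHull (N := N) hr hrC
    exact ⟨κ, fun F hF hdF M R hMR => hκ F hF hdF (M, R) hMR.1⟩
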